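/- All graphs are finite, simple and undirected. For a graph $G$ let $D(G)=\{(u,v),(v,u): uv\in E(G)\}$, and let the system matrix $A_{\mathrm{sys}}(G)$ be the $D(G)\times D(G)$ matrix with $A_{\mathrm{sys}}(G)(i,j)=1$ if the second entry of $j$ equals the first entry of $i$ and the first entry of $j$ differs from the second entry of $i$, and $A_{\mathrm{sys}}(G)(i,j)=0$ otherwise. Let $\rho(M)$ denote the spectral radius of a matrix $M$, i.e. the maximum modulus of its complex eigenvalues. For $uv\in E(G)$ let $G_{uv}$ be the graph obtained from $G$ by subdividing the edge $uv$, i.e. by replacing it with a path $u\,w\,v$ through a new vertex $w$. (1) Let $G$ be a connected graph with no vertex of degree one, and assume that $G$ is not a cycle and is not regular. Then for every edge $uv\in E(G)$, $$\rho(A_{\mathrm{sys}}(G_{uv}))<\rho(A_{\mathrm{sys}}(G)).$$ (2) Let $\theta(l_1,l_2,l_3)$ be the theta graph formed by three internally disjoint paths of lengths $l_1,l_2,l_3$ with common (distinct) endpoints, where $l_1\ge 1$ and $l_2,l_3\ge 2$. Then each of $\rho(A_{\mathrm{sys}}(\theta(l_1+1,l_2,l_3)))$, $\rho(A_{\mathrm{sys}}(\theta(l_1,l_2+1,l_3)))$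 and $\rho(A_{\mathrm{sys}}(\theta(l_1,l_2,l_3+1)))$ is strictly smaller than $\rho(A_{\mathrm{sys}}(\theta(l_1,l_2,l_3)))$. (3) For $r_1,r_2\ge 3$ and $q\ge 0$ let $D_b(r_1,r_2;q)$ be the dumbbell graph, consisting of two cycles of lengths $r_1$ and $r_2$ which, if $q\ge 1$, are vertex-disjoint and joined by a path of length $q$ that shares only its endpoints with the two cycles (one with each), and which, if $q=0$, have exactly one common vertex. Then $\rho(A_{\mathrm{sys}}(D_b(r_1+1,r_2;q)))$ and $\rho(A_{\mathrm{sys}}(D_b(r_1,r_2+1;q)))$ are strictly smaller than $\rho(A_{\mathrm{sys}}(D_b(r_1,r_2;q)))$; and if $q\ge 1$, then also $\rho(A_{\mathrm{sys}}(D_b(r_1,r_2;q+1)))<\rho(A_{\mathrm{sys}}(D_b(r_1,r_2;q)))$. -/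

import Mathlib

open scoped ENNReal

/-- The graph obtained from `G` by subdividing the edge `uv`: the edge `uv` is deleted, and a new
vertex `none` is added, joined to exactly `u` and `v`. (Meant for adjacent `u` and `v`.) -/
def SimpleGraph.subdivide {V : Type*} (G : SimpleGraph V) (u v : V) : SimpleGraph (Option V) where
  Adj
    | none, none => False
    | none, some b => b = u ∨ b = v
    | some a, none => a = u ∨ a = v
    | some a, some b => G.Adj a b ∧ s(a, b) ≠ s(u, v)
  symm := ⟨by
    rintro (_ | a) (_ | b) h
    · exact h
    · exact h
    · exact h
    · exact ⟨h.1.symm, fun e => h.2 (Sym2.eq_swap.trans e)⟩⟩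
  loopless := ⟨by
    rintro (_ | a) h
    · exact h
    · exact h.1.ne rfl⟩

/-- `G` is a cycle `C_n`, for some length `n ≥ 3`. -/
def SimpleGraph.IsCycleGraph {V : Type*} (G : SimpleGraph V) : Prop :=
  ∃ n : ℕ, 3 ≤ n ∧ Nonempty (G ≃g SimpleGraph.cycleGraph n)

open Classical in
/-- The system matrix `A_sys(G)`. Rows and columns are indexed by the ordered pairs `(a, b)` of
adjacent vertices; the entry at `(i, j)` is `1` if the second entry of `j` equals the first entry
of `i` and the first entry of `j` differs from the second entry of `i`, and it is `0` otherwise. -/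
noncomputable def SimpleGraph.sysMatrix {V : Type*} (G : SimpleGraph V) :
    Matrix G.Dart G.Dart ℝ :=
  Matrix.of fun i j => if j.snd = i.fst ∧ j.fst ≠ i.snd then 1 else 0

/-- The spectral radius of a square real matrix: the supremum (here a maximum, when `n` is
nonempty) of the moduli of its complex eigenvalues. -/
noncomputable def Matrix.rho {n : Type*} [Fintype n] [DecidableEq n] (M : Matrix n n ℝ) : ℝ≥0∞ :=
  spectralRadius ℂ (M.map (algebraMap ℝ ℂ))

open Classical in
/-- The spectral radius of the system matrix of a finite graph. -/
noncomputable def SimpleGraph.rhoSys {V : Type*} [Fintype V] (G : SimpleGraph V) : ℝ≥0∞ :=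
  G.sysMatrix.rho

/-- The theta graph `θ(l₁, l₂, l₃)`, for `1 ≤ l₁` and `2 ≤ l₂, l₃`, on the vertices
`0, 1, …, l₁ + l₂ + l₃ - 2`. Consecutive vertices are adjacent, and there are two more edges,
`{0, l₁ + l₂ - 1}` and `{l₂ - 1, l₁ + l₂ + l₃ - 2}`. With `b = l₂ - 1` and `a = l₁ + l₂ - 1`, it
consists of three internally disjoint paths from `b` to `a`:
* `b, b + 1, …, a`, of length `l₁`;
* `b, b - 1, …, 1, 0, a`, of length `l₂`;
* `b, l₁ + l₂ + l₃ - 2, …, a + 1, a`, of length `l₃`. -/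
def thetaGraph (l₁ l₂ l₃ : ℕ) : SimpleGraph (Fin (l₁ + l₂ + l₃ - 1)) :=
  SimpleGraph.fromRel fun i j =>
    (j : ℕ) = i + 1 ∨
    ((i : ℕ) = 0 ∧ (j : ℕ) + 1 = l₁ + l₂) ∨
    ((i : ℕ) + 1 = l₂ ∧ (j : ℕ) + 2 = l₁ + l₂ + l₃)

/-- The dumbbell graph `D_b(r₁, r₂; q)`, for `3 ≤ r₁, r₂`, on the vertices
`0, 1, …, r₁ + q + r₂ - 2`. Consecutive vertices are adjacent, and there are two more edges,
`{0, r₁ - 1}` and `{r₁ + q - 1, r₁ + q + r₂ - 2}`. It consists of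
* the cycle `0, 1, …, r₁ - 1`, of length `r₁`;
* the path `r₁ - 1, r₁, …, r₁ + q - 1`, of length `q`;
* the cycle `r₁ + q - 1, …, r₁ + q + r₂ - 2`, of length `r₂`.
For `q = 0` the two cycles share exactly the vertex `r₁ - 1`. -/
def dumbbellGraph (r₁ r₂ q : ℕ) : SimpleGraph (Fin (r₁ + q + r₂ - 1)) :=
  SimpleGraph.fromRel fun i j =>
    (j : ℕ) = i + 1 ∨
    ((i : ℕ) = 0 ∧ (j : ℕ) + 1 = r₁) ∨
    ((i : ℕ) + 1 = r₁ + q ∧ (j : ℕ) + 2 = r₁ + q + r₂)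

/-!
The system matrix is the non-backtracking matrix of the graph: its entry at `(i, j)` is `1` exactly
when the dart `i` continues the dart `j` without backtracking. Everything follows from one fact,
`SimpleGraph.rhoSys_subdivide_lt`: in a connected graph with all degrees at least two and some degree
at least three, subdividing an edge strictly decreases the spectral radius.

Let `μ` be the spectral radius of the subdivided graph `H`. The entrywise modulus `y` of a dominant
eigenvector satisfies `μ y ≤ B_H y` (`Matrix.exists_rho_eq_ofReal`). Each dart `d` of `G` starts in a
dart of `H` (its first half, if `d` runs along the subdivided edge) and ends in a dart of `H` (its
second half). Let `x d` be the value of `y` where `d` starts. The second half has the first half as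
its only predecessor, so `y` shrinks along it by a factor of at least `μ`; as the predecessors in
`H` of the start of `i` are the ends of the predecessors of `i` in `G`, this gives `μ x ≤ B_G x` when
`1 < μ`. Equality would force `y`, and with it `x`, to vanish on the subdivided edge.

The strict inequality then comes from the irreducibility of `B_G` (`Matrix.ofReal_lt_rho`,
`Matrix.pos_of_mulVec_eq`), which is `SimpleGraph.Dart.reflTransGen_follows`: the uniform
non-backtracking walk is doubly stochastic, so a set of darts closed under successors is closed
under predecessors; by connectedness it meets every vertex, and at a vertex of degree at least three
it contains all outgoing darts, hence by reversal everything is reachable. The case `μ ≤ 1` is `SimpleGraph.one_lt_rhoSys`.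

Theta and dumbbell graphs are both paths `0, …, N - 1` with two chords `{0, b}` and `{c, N - 1}`;
lengthening one of their constituents is the subdivision of a suitable edge `{k, k + 1}` of the path.
-/

/-! ### Nonnegative matrices: subinvariant vectors and the spectral radius -/

section NonnegMatrix

open Matrix Filter Topology

theorem Matrix.mulVec_nonneg_of_nonneg {n : Type*} [Fintype n] {B : Matrix n n ℝ}
    (hB : ∀ i j, 0 ≤ B i j) {x : n → ℝ} (hx : 0 ≤ x) : 0 ≤ B *ᵥ x :=
  fun i => Finset.sum_nonneg fun j _ => mul_nonneg (hB i j) (hx j)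

variable {n : Type*} [Fintype n] [DecidableEq n]

attribute [local instance] Matrix.linftyOpNormedRing Matrix.linftyOpNormedAlgebra

theorem Matrix.pow_mul_le_pow_mulVec {B : Matrix n n ℝ} (hB : ∀ i j, 0 ≤ B i j) {x : n → ℝ} {μ : ℝ}
    (hμ : 0 ≤ μ) (h : ∀ i, μ * x i ≤ (B *ᵥ x) i) (k : ℕ) (i : n) :
    μ ^ k * x i ≤ (B ^ k *ᵥ x) i := by
  induction k generalizing i with
  | zero => simp
  | succ k ih =>
    rw [pow_succ' B, ← Matrix.mulVec_mulVec]
    calc μ ^ (k + 1) * x i = μ ^ k * (μ * x i) := by ring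
      _ ≤ μ ^ k * (B *ᵥ x) i := by gcongr; exact h i
      _ = ∑ j, B i j * (μ ^ k * x j) := by
        simp only [Matrix.mulVec, dotProduct, Finset.mul_sum]
        exact Finset.sum_congr rfl fun j _ => by ring
      _ ≤ (B *ᵥ (B ^ k *ᵥ x)) i :=
        Finset.sum_le_sum fun j _ => mul_le_mul_of_nonneg_left (ih j) (hB i j)

/-- The easy half of the Collatz–Wielandt bound: a nonnegative vector `x ≠ 0` with `μ x ≤ B x`
forces the powers of `B` to grow at least like `μ ^ k`, so Gelfand's formula gives `μ ≤ ρ(B)`. -/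
theorem Matrix.ofReal_le_rho {B : Matrix n n ℝ} (hB : ∀ i j, 0 ≤ B i j) {x : n → ℝ} {μ : ℝ}
    (hμ : 0 ≤ μ) (hx : 0 ≤ x) (hx0 : x ≠ 0) (h : ∀ i, μ * x i ≤ (B *ᵥ x) i) :
    ENNReal.ofReal μ ≤ B.rho := by
  obtain ⟨i, hi⟩ : ∃ i, 0 < x i := by
    obtain ⟨i, hi⟩ := Function.ne_iff.mp hx0
    exact ⟨i, lt_of_le_of_ne (hx i) (Ne.symm hi)⟩
  set A : Matrix n n ℂ := B.map (algebraMap ℝ ℂ) with hA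
  set v : n → ℂ := fun j => (x j : ℂ) with hv
  have hAv : ∀ k, μ ^ k * x i ≤ ‖A ^ k‖ * ‖v‖ := fun k => by
    have e : (A ^ k *ᵥ v) i = (((B ^ k *ᵥ x) i : ℝ) : ℂ) := by
      have : A ^ k = (B ^ k).map (algebraMap ℝ ℂ) := by
        rw [hA, Matrix.map_pow]
      rw [this]
      simp [Matrix.mulVec, dotProduct, hv]
    calc μ ^ k * x i ≤ (B ^ k *ᵥ x) i := pow_mul_le_pow_mulVec hB hμ h k i
      _ ≤ ‖(A ^ k *ᵥ v) i‖ := by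
        rw [e, Complex.norm_real]; exact le_abs_self _
      _ ≤ ‖A ^ k *ᵥ v‖ := norm_le_pi_norm _ i
      _ ≤ ‖A ^ k‖ * ‖v‖ := Matrix.linfty_opNorm_mulVec _ _
  by_contra hlt
  rw [not_le] at hlt
  obtain ⟨r, hr1, hr2⟩ := ENNReal.lt_iff_exists_nnreal_btwn.mp hlt
  have hrμ : (r : ℝ) < μ := by
    rw [ENNReal.ofReal, ENNReal.coe_lt_coe] at hr2
    exact Real.lt_toNNReal_iff_coe_lt.mp hr2
  have hμ0 : 0 < μ := lt_of_le_of_lt r.2 hrμ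
  have hG := spectrum.pow_nnnorm_pow_one_div_tendsto_nhds_spectralRadius A
  have ev : ∀ᶠ k : ℕ in atTop, ‖A ^ k‖ ≤ (r : ℝ) ^ k := by
    filter_upwards [hG.eventually_lt_const hr1, eventually_gt_atTop 0] with k hk hk0
    have h1 : (‖A ^ k‖₊ : ℝ≥0∞) < (r : ℝ≥0∞) ^ (k : ℝ) := by
      rw [one_div] at hk
      exact (ENNReal.rpow_inv_lt_iff (by exact_mod_cast hk0)).mp hk
    rw [ENNReal.rpow_natCast] at h1
    exact_mod_cast h1.le
  have ev2 : ∀ᶠ k : ℕ in atTop, x i ≤ ((r : ℝ) / μ) ^ k * ‖v‖ := by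
    filter_upwards [ev] with k hk
    have h2 := (hAv k).trans (mul_le_mul_of_nonneg_right hk (norm_nonneg v))
    rw [div_pow, div_mul_eq_mul_div, le_div_iff₀ (pow_pos hμ0 k)]
    linarith
  have lim : Tendsto (fun k : ℕ => ((r : ℝ) / μ) ^ k * ‖v‖) atTop (𝓝 (0 * ‖v‖)) :=
    (tendsto_pow_atTop_nhds_zero_of_lt_one (div_nonneg r.2 hμ)
      ((div_lt_one hμ0).mpr hrμ)).mul_const _
  have := ge_of_tendsto lim ev2
  linarith

/-- The entrywise modulus of an eigenvector for an eigenvalue of largest modulus is a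
subinvariant vector for the spectral radius. -/
theorem Matrix.exists_rho_eq_ofReal [Nonempty n] {B : Matrix n n ℝ} (hB : ∀ i j, 0 ≤ B i j) :
    ∃ (μ : ℝ) (x : n → ℝ), B.rho = ENNReal.ofReal μ ∧ 0 ≤ μ ∧ 0 ≤ x ∧ x ≠ 0 ∧
      ∀ i, μ * x i ≤ (B *ᵥ x) i := by
  obtain ⟨z, hz, hzr⟩ := spectrum.exists_nnnorm_eq_spectralRadius (B.map (algebraMap ℝ ℂ))
  rw [← Matrix.spectrum_toLin', ← Module.End.hasEigenvalue_iff_mem_spectrum] at hz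
  obtain ⟨v, hv⟩ := hz.exists_hasEigenvector
  have he : B.map (algebraMap ℝ ℂ) *ᵥ v = z • v := by
    simpa [Matrix.toLin'_apply] using hv.apply_eq_smul
  refine ⟨‖z‖, fun i => ‖v i‖, ?_, norm_nonneg _, fun i => norm_nonneg _, fun h0 => hv.2 ?_,
    fun i => ?_⟩
  · rw [ofReal_norm, Matrix.rho, ← hzr]; rfl
  · funext i
    exact norm_eq_zero.mp (congrFun h0 i)
  · calc ‖z‖ * ‖v i‖ = ‖(B.map (algebraMap ℝ ℂ) *ᵥ v) i‖ := by rw [he]; simp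
      _ ≤ ∑ j, ‖(B.map (algebraMap ℝ ℂ)) i j * v j‖ := norm_sum_le _ _
      _ = (B *ᵥ fun i => ‖v i‖) i := by
        refine Finset.sum_congr rfl fun j _ => ?_
        simp [abs_of_nonneg (hB i j)]

theorem Matrix.one_add_pow_succ_mulVec (B : Matrix n n ℝ) (f : n → ℝ) (k : ℕ) :
    (1 + B) ^ (k + 1) *ᵥ f = (1 + B) ^ k *ᵥ f + B *ᵥ ((1 + B) ^ k *ᵥ f) := by
  rw [pow_succ', ← Matrix.mulVec_mulVec, Matrix.add_mulVec, Matrix.one_mulVec]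

theorem Matrix.one_add_pow_mulVec_nonneg {B : Matrix n n ℝ} (hB : ∀ i j, 0 ≤ B i j) {f : n → ℝ}
    (hf : 0 ≤ f) (k : ℕ) : 0 ≤ (1 + B) ^ k *ᵥ f := by
  induction k with
  | zero => simpa using hf
  | succ k ih =>
    rw [one_add_pow_succ_mulVec]
    exact add_nonneg ih (mulVec_nonneg_of_nonneg hB ih)

/-- For an irreducible `B`, the powers of `1 + B` spread any nonzero nonnegative vector over all
coordinates. -/
theorem Matrix.exists_one_add_pow_mulVec_pos {B : Matrix n n ℝ} (hB : ∀ i j, 0 ≤ B i j)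
    (hirr : ∀ i j, Relation.ReflTransGen (fun i j => 0 < B j i) i j) {f : n → ℝ}
    (hf : 0 ≤ f) (hf0 : f ≠ 0) : ∃ k, ∀ i, 0 < ((1 + B) ^ k *ᵥ f) i := by
  obtain ⟨i₀, hi₀⟩ : ∃ i, 0 < f i := by
    obtain ⟨i, hi⟩ := Function.ne_iff.mp hf0
    exact ⟨i, lt_of_le_of_ne (hf i) (Ne.symm hi)⟩
  have hnn := one_add_pow_mulVec_nonneg hB hf
  have hmono : Monotone fun k => (1 + B) ^ k *ᵥ f := by
    refine monotone_nat_of_le_succ fun k => ?_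
    rw [one_add_pow_succ_mulVec]
    exact le_add_of_nonneg_right (mulVec_nonneg_of_nonneg hB (hnn k))
  have hex : ∀ i, ∃ k, 0 < ((1 + B) ^ k *ᵥ f) i := fun i => by
    induction hirr i₀ i with
    | refl => exact ⟨0, by simpa using hi₀⟩
    | @tail j l _ hjl ih =>
      obtain ⟨k, hk⟩ := ih
      refine ⟨k + 1, ?_⟩
      rw [one_add_pow_succ_mulVec]
      refine add_pos_of_nonneg_of_pos (hnn k l) ?_
      exact Finset.sum_pos' (fun m _ => mul_nonneg (hB l m) (hnn k m))
        ⟨j, Finset.mem_univ j, mul_pos hjl hk⟩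
  choose k hk using hex
  exact ⟨Finset.univ.sup k, fun i =>
    (hk i).trans_le (hmono (Finset.le_sup (f := k) (Finset.mem_univ i)) i)⟩

/-- A nonnegative eigenvector of an irreducible matrix has no zero entry. -/
theorem Matrix.pos_of_mulVec_eq {B : Matrix n n ℝ} (hB : ∀ i j, 0 ≤ B i j)
    (hirr : ∀ i j, Relation.ReflTransGen (fun i j => 0 < B j i) i j) {x : n → ℝ} {μ : ℝ}
    (hμ : 0 ≤ μ) (hx : 0 ≤ x) (hx0 : x ≠ 0) (h : B *ᵥ x = μ • x) (i : n) : 0 < x i := by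
  obtain ⟨k, hk⟩ := exists_one_add_pow_mulVec_pos hB hirr hx hx0
  have e : ∀ k : ℕ, (1 + B) ^ k *ᵥ x = (1 + μ) ^ k • x := fun k => by
    induction k with
    | zero => simp
    | succ k ih =>
      rw [one_add_pow_succ_mulVec, ih, Matrix.mulVec_smul, h, pow_succ, smul_smul, ← add_smul]
      congr 1; ring
  have := hk i
  rw [e] at this
  exact pos_of_mul_pos_right this (by positivity)

/-- For an irreducible matrix, a nonnegative vector that is subinvariant for `μ` but is no
eigenvector witnesses the strict inequality `μ < ρ(B)`: after spreading it by a power of `1 + B`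
the subinvariance is strict in every coordinate, which leaves room for a larger `μ`. -/
theorem Matrix.ofReal_lt_rho {B : Matrix n n ℝ} (hB : ∀ i j, 0 ≤ B i j)
    (hirr : ∀ i j, Relation.ReflTransGen (fun i j => 0 < B j i) i j) {x : n → ℝ} {μ : ℝ}
    (hμ : 0 ≤ μ) (hx : 0 ≤ x) (h : ∀ i, μ * x i ≤ (B *ᵥ x) i)
    (hne : B *ᵥ x ≠ μ • x) : ENNReal.ofReal μ < B.rho := by
  obtain ⟨k, hk⟩ := exists_one_add_pow_mulVec_pos hB hirr (f := B *ᵥ x - μ • x)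
    (fun i => sub_nonneg.mpr (h i)) (sub_ne_zero.mpr hne)
  set y := (1 + B) ^ k *ᵥ x with hy
  have hcomm : (1 + B) ^ k *ᵥ (B *ᵥ x - μ • x) = B *ᵥ y - μ • y := by
    have hc : (1 + B) ^ k * B = B * (1 + B) ^ k :=
      (((Commute.one_left B).add_left (Commute.refl B)).pow_left k).eq
    rw [Matrix.mulVec_sub, Matrix.mulVec_smul, Matrix.mulVec_mulVec, hc, ← Matrix.mulVec_mulVec]
  have hstrict : ∀ i, μ * y i < (B *ᵥ y) i := fun i => by
    have := hk i
    rw [hcomm] at this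
    exact sub_pos.mp this
  have hy0 : 0 ≤ y := one_add_pow_mulVec_nonneg hB hx k
  have hyne : y ≠ 0 := fun h0 => hne (by
    funext i
    have := hstrict i
    simp [h0] at this)
  have ev : ∀ᶠ ν in 𝓝[>] μ, ∀ i, ν * y i < (B *ᵥ y) i := by
    refine eventually_all.mpr fun i => nhdsWithin_le_nhds ?_
    have : Tendsto (fun ν : ℝ => ν * y i) (𝓝 μ) (𝓝 (μ * y i)) := tendsto_id.mul_const _
    exact this.eventually_lt_const (hstrict i)
  obtain ⟨ν, hν, hμν⟩ := (ev.and self_mem_nhdsWithin).exists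
  have hμν : μ < ν := hμν
  exact ((ENNReal.ofReal_lt_ofReal_iff (hμ.trans_lt hμν)).mpr hμν).trans_le
    (ofReal_le_rho hB (hμ.trans hμν.le) hy0 hyne fun i => (hν i).le)

theorem Matrix.rho_reindex {m : Type*} [Fintype m] [DecidableEq m] (e : m ≃ n)
    (M : Matrix m m ℝ) : (M.reindex e e).rho = M.rho := by
  have : (M.reindex e e).map (algebraMap ℝ ℂ) =
      Matrix.reindexAlgEquiv ℂ ℂ e (M.map (algebraMap ℝ ℂ)) := rfl
  rw [Matrix.rho, Matrix.rho, spectralRadius, spectralRadius, this, AlgEquiv.spectrum_eq]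

end NonnegMatrix

/-! ### The non-backtracking relation on darts -/

/-- A forward closed set of a doubly stochastic chain is backward closed: no mass leaves the set,
hence none enters it. -/
theorem mem_of_doublyStochastic_of_closed {α : Type*} [Fintype α] {P : α → α → ℝ}
    (h0 : ∀ a b, 0 ≤ P a b) (hrow : ∀ a, ∑ b, P a b = 1) (hcol : ∀ b, ∑ a, P a b = 1)
    {S : Set α} (hS : ∀ a b, a ∈ S → P a b ≠ 0 → b ∈ S) {a b : α} (hb : b ∈ S)
    (hab : P a b ≠ 0) : a ∈ S := by
  classical
  by_contra ha
  let T : Finset α := Finset.univ.filter (· ∈ S)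
  have hT : ∀ {c}, c ∈ T ↔ c ∈ S := by simp [T]
  have h1 : ∑ c ∈ T, ∑ d ∈ T, P c d = ∑ d ∈ T, ∑ c, P c d := by
    rw [Finset.sum_congr rfl fun d _ => hcol d, ← Finset.sum_congr rfl fun c (_ : c ∈ T) => hrow c]
    refine Finset.sum_congr rfl fun c hc => Finset.sum_subset (Finset.subset_univ _) ?_
    intro d _ hd
    by_contra hP
    exact hd (hT.mpr (hS c d (hT.mp hc) hP))
  rw [Finset.sum_comm] at h1
  refine absurd h1 (ne_of_lt (Finset.sum_lt_sum (fun d _ => ?_) ⟨b, hT.mpr hb, ?_⟩))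
  · exact Finset.sum_le_sum_of_subset_of_nonneg (Finset.subset_univ _) fun c _ _ => h0 c d
  · exact Finset.sum_lt_sum_of_subset (Finset.subset_univ _) (Finset.mem_univ a)
      (fun h => ha (hT.mp h)) ((h0 a b).lt_of_ne' hab) fun c _ _ => h0 c b

namespace SimpleGraph

variable {V : Type*} {G : SimpleGraph V}

/-- The dart `b` continues the dart `a` without backtracking: `b` starts where `a` ends and is not
the reverse of `a`. -/
def Dart.Follows (a b : G.Dart) : Prop := a.snd = b.fst ∧ a.fst ≠ b.snd

theorem Dart.Follows.symm {a b : G.Dart} (h : a.Follows b) : b.symm.Follows a.symm :=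
  ⟨h.1.symm, h.2.symm⟩

theorem Dart.reflTransGen_follows_symm {a b : G.Dart}
    (h : Relation.ReflTransGen Dart.Follows a b) :
    Relation.ReflTransGen Dart.Follows b.symm a.symm := by
  induction h with
  | refl => exact .refl
  | tail _ h ih => exact .head h.symm ih

section Finite

variable [Fintype V] [DecidableRel G.Adj]

open Classical in
theorem Dart.card_follows (a : G.Dart) :
    ((Finset.univ.filter fun b => a.Follows b).card : ℝ) = G.degree a.snd - 1 := by
  have h : (Finset.univ.filter fun b => a.Follows b) =
      (Finset.univ.filter fun b : G.Dart => b.fst = a.snd).erase a.symm := by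
    ext b
    rw [Finset.mem_erase, Finset.mem_filter, Finset.mem_filter]
    simp only [Finset.mem_univ, true_and]
    constructor
    · rintro ⟨h1, h2⟩
      exact ⟨fun e => h2 (by rw [e]; rfl), h1.symm⟩
    · rintro ⟨h1, h2⟩
      refine ⟨h2.symm, fun e => h1 (Dart.ext _ _ (Prod.ext h2 e.symm))⟩
  have hm : a.symm ∈ Finset.univ.filter fun b : G.Dart => b.fst = a.snd := by simp
  rw [h, ← G.dart_fst_fiber_card_eq_degree a.snd, ← Finset.card_erase_add_one hm]
  push_cast
  ring

open Classical in
theorem Dart.card_follows' (b : G.Dart) :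
    ((Finset.univ.filter fun a : G.Dart => a.Follows b).card : ℝ) = G.degree b.fst - 1 := by
  have := Dart.card_follows b.symm
  rw [show b.symm.snd = b.fst from rfl] at this
  rw [← this, Nat.cast_inj]
  refine Finset.card_bij (fun a _ => a.symm) ?_ ?_ ?_
  · intro a ha
    simpa using (Finset.mem_filter.mp ha).2.symm
  · intro a _ c _ h
    exact Dart.symm_involutive.injective h
  · intro c hc
    refine ⟨c.symm, ?_, by simp⟩
    simpa using (Finset.mem_filter.mp hc).2.symm

/-- With all degrees at least two, stepping to a uniformly random non-backtracking continuation is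
a doubly stochastic chain, so a set of darts closed under continuations is closed under taking
predecessors. -/
theorem Dart.mem_of_follows_of_closed (hdeg : ∀ v, 2 ≤ G.degree v) {S : Set G.Dart}
    (hS : ∀ a b, a ∈ S → a.Follows b → b ∈ S) {a b : G.Dart} (hb : b ∈ S) (hab : a.Follows b) :
    a ∈ S := by
  classical
  have hpos : ∀ v, (0 : ℝ) < G.degree v - 1 := fun v => by
    have : (2 : ℝ) ≤ G.degree v := by exact_mod_cast hdeg v
    linarith
  refine mem_of_doublyStochastic_of_closed
    (P := fun a b : G.Dart => if a.Follows b then ((G.degree a.snd : ℝ) - 1)⁻¹ else 0)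
    ?_ ?_ ?_ ?_ hb ?_
  · intro c d
    split_ifs
    · exact (inv_pos.mpr (hpos _)).le
    · exact le_rfl
  · intro c
    rw [← Finset.sum_filter, Finset.sum_const, nsmul_eq_mul, Dart.card_follows,
      mul_inv_cancel₀ (hpos _).ne']
  · intro d
    rw [← Finset.sum_filter, Finset.sum_congr rfl (g := fun _ => ((G.degree d.fst : ℝ) - 1)⁻¹),
      Finset.sum_const, nsmul_eq_mul, Dart.card_follows', mul_inv_cancel₀ (hpos _).ne']
    intro c hc
    rw [(Finset.mem_filter.mp hc).2.1]
  · intro c d hc hcd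
    exact hS c d hc (by by_contra h; simp [h] at hcd)
  · simpa [hab] using (hpos a.snd).ne'

theorem exists_adj_ne (hdeg : ∀ v, 2 ≤ G.degree v) (v x : V) : ∃ z, G.Adj v z ∧ z ≠ x := by
  obtain ⟨z, hz, hne⟩ := Finset.exists_mem_ne (hdeg v) x
  exact ⟨z, (G.mem_neighborFinset v z).mp hz, hne⟩

/-- **Irreducibility of the non-backtracking relation.** The darts reachable from `a` form a set
closed under successors and predecessors. By connectedness it contains a dart at every vertex, in
particular at a vertex of degree at least three, and there it can be turned around. -/
theorem Dart.reflTransGen_follows (hconn : G.Connected) (hdeg : ∀ v, 2 ≤ G.degree v)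
    (hthree : ∃ v, 3 ≤ G.degree v) (a b : G.Dart) :
    Relation.ReflTransGen Dart.Follows a b := by
  classical
  obtain ⟨y, hy⟩ := hthree
  have key : ∀ a : G.Dart, (∀ d : G.Dart, d.fst = y → Relation.ReflTransGen Dart.Follows a d) ∧
      ∃ d : G.Dart, d.snd = y ∧ Relation.ReflTransGen Dart.Follows a d := by
    intro a
    let S : Set G.Dart := {b | Relation.ReflTransGen Dart.Follows a b}
    have hfwd : ∀ c d, c ∈ S → c.Follows d → d ∈ S := fun c d hc hcd =>
      Relation.ReflTransGen.tail hc hcd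
    have hbwd : ∀ c d, d ∈ S → c.Follows d → c ∈ S := fun c d hd hcd =>
      Dart.mem_of_follows_of_closed hdeg hfwd hd hcd
    have hstep : ∀ x x', (∃ d ∈ S, d.fst = x) → G.Adj x x' → ∃ d ∈ S, d.fst = x' := by
      rintro x x' ⟨d, hd, rfl⟩ hx
      by_cases h : d.snd = x'
      · obtain ⟨z, hz, hne⟩ := exists_adj_ne hdeg x' d.fst
        exact ⟨⟨(x', z), hz⟩, hfwd d _ hd ⟨h, hne.symm⟩, rfl⟩
      · exact ⟨⟨(x', d.fst), hx.symm⟩, hbwd _ d hd ⟨rfl, fun e => h e.symm⟩, rfl⟩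
    have hall : ∃ d ∈ S, d.fst = y := by
      obtain ⟨p⟩ := hconn.preconnected a.fst y
      have : ∀ {x x' : V}, G.Walk x x' → (∃ d ∈ S, d.fst = x) → ∃ d ∈ S, d.fst = x' := by
        intro x x' p
        induction p with
        | nil => exact id
        | cons h _ ih => exact fun hx => ih (hstep _ _ hx h)
      exact this p ⟨a, Relation.ReflTransGen.refl, rfl⟩
    obtain ⟨d, hd, rfl⟩ := hall
    have hin : ∀ z (h : G.Adj z d.fst), z ≠ d.snd → (⟨(z, d.fst), h⟩ : G.Dart) ∈ S :=
      fun z h hz => hbwd _ d hd ⟨rfl, hz⟩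
    refine ⟨fun e he => ?_, ?_⟩
    · by_cases hed : e.snd = d.snd
      · rw [Dart.ext e d (Prod.ext he hed)]
        exact hd
      · -- `z → d.fst` precedes `d` when `z ≠ d.snd`, and is continued by `e` when `z ≠ e.snd`
        obtain ⟨z, hz, hzn⟩ : ∃ z, G.Adj d.fst z ∧ z ≠ d.snd ∧ z ≠ e.snd := by
          by_contra! hcon
          have hsub : G.neighborFinset d.fst ⊆ {d.snd, e.snd} := fun z hz => by
            rw [Finset.mem_insert, Finset.mem_singleton, or_iff_not_imp_left]
            exact hcon z ((G.mem_neighborFinset _ z).mp hz)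
          have := (Finset.card_le_card hsub).trans Finset.card_le_two
          rw [G.card_neighborFinset_eq_degree] at this
          omega
        exact hfwd _ e (hin z hz.symm hzn.1) ⟨he.symm, hzn.2⟩
    · obtain ⟨z, hz, hne⟩ := exists_adj_ne hdeg d.fst d.snd
      exact ⟨_, rfl, hin z hz.symm hne⟩
  obtain ⟨d, hd, had⟩ := (key a).2
  have := Dart.reflTransGen_follows_symm ((key b.symm).1 d.symm hd)
  rw [Dart.symm_symm, Dart.symm_symm] at this
  exact had.trans this

end Finite

end SimpleGraph

/-! ### The system matrix -/

namespace SimpleGraph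

variable {V : Type*} {G : SimpleGraph V}

theorem rhoSys_eq [Fintype V] [Fintype G.Dart] [DecidableEq G.Dart] :
    G.rhoSys = G.sysMatrix.rho := by
  rw [rhoSys]
  congr!

theorem rhoSys_congr {W : Type*} [Fintype V] [Fintype W] {H : SimpleGraph W} (e : G ≃g H) :
    G.rhoSys = H.rhoSys := by
  classical
  let f : G.Dart ≃ H.Dart :=
    { toFun := fun d => e.toHom.mapDart d
      invFun := fun d => e.symm.toHom.mapDart d
      left_inv := fun d => Dart.ext _ _
        (Prod.ext (e.symm_apply_apply _) (e.symm_apply_apply _))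
      right_inv := fun d => Dart.ext _ _
        (Prod.ext (e.apply_symm_apply _) (e.apply_symm_apply _)) }
  rw [rhoSys_eq, rhoSys_eq, ← Matrix.rho_reindex f]
  congr 1
  ext i j
  simp [sysMatrix, f]

theorem sysMatrix_nonneg (i j : G.Dart) : 0 ≤ G.sysMatrix i j := by
  simp only [sysMatrix, Matrix.of_apply]
  split_ifs
  · exact zero_le_one
  · exact le_rfl

theorem sysMatrix_pos_of_follows {i j : G.Dart} (h : j.Follows i) : 0 < G.sysMatrix i j := by
  have : j.snd = i.fst ∧ j.fst ≠ i.snd := h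
  simp [sysMatrix, this]

open Classical in
theorem sysMatrix_mulVec [Fintype G.Dart] (x : G.Dart → ℝ) (i : G.Dart) :
    (G.sysMatrix.mulVec x) i = ∑ j with j.Follows i, x j := by
  rw [Finset.sum_filter]
  refine Finset.sum_congr rfl fun j _ => ?_
  simp only [sysMatrix, Matrix.of_apply, ite_mul, one_mul, zero_mul]
  congr

theorem reflTransGen_sysMatrix_pos [Fintype V] [DecidableRel G.Adj] (hconn : G.Connected)
    (hdeg : ∀ v, 2 ≤ G.degree v) (hthree : ∃ v, 3 ≤ G.degree v) (i j : G.Dart) :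
    Relation.ReflTransGen (fun i j => 0 < G.sysMatrix j i) i j :=
  Relation.ReflTransGen.mono (fun _ _ h => sysMatrix_pos_of_follows h) _ _
    (Dart.reflTransGen_follows hconn hdeg hthree i j)

/-- The constant vector is subinvariant for `1`, strictly so at the darts leaving a vertex of
degree at least three. -/
theorem one_lt_rhoSys [Fintype V] [DecidableRel G.Adj] (hconn : G.Connected)
    (hdeg : ∀ v, 2 ≤ G.degree v) (hthree : ∃ v, 3 ≤ G.degree v) : 1 < G.rhoSys := by
  classical
  have hval : ∀ i : G.Dart, (G.sysMatrix.mulVec fun _ => (1 : ℝ)) i = G.degree i.fst - 1 := by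
    intro i
    rw [sysMatrix_mulVec, ← Dart.card_follows' i]
    simp
  rw [rhoSys_eq, ← ENNReal.ofReal_one]
  refine Matrix.ofReal_lt_rho sysMatrix_nonneg (reflTransGen_sysMatrix_pos hconn hdeg hthree)
    zero_le_one (x := fun _ => 1) (fun _ => zero_le_one) (fun i => ?_) fun h => ?_
  · rw [hval]
    have : (2 : ℝ) ≤ G.degree i.fst := by exact_mod_cast hdeg i.fst
    linarith
  · obtain ⟨y, hy⟩ := hthree
    obtain ⟨z, hz, -⟩ := exists_adj_ne hdeg y y
    have h1 := congrFun h ⟨(y, z), hz⟩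
    rw [hval] at h1
    have : (3 : ℝ) ≤ G.degree y := by exact_mod_cast hy
    simp at h1
    linarith

/-! ### Subdividing an edge -/

open Classical in
/-- The neighbour of `some c` in the subdivided graph that lies in the direction of the
neighbour `a` of `c`. -/
noncomputable def subdivideNbr (u v c a : V) : Option V :=
  if s(c, a) = s(u, v) then none else some a

theorem subdivideNbr_injective (u v c : V) : Function.Injective (subdivideNbr u v c) := by
  intro a b h
  unfold subdivideNbr at h
  split_ifs at h with h1 h2
  · exact Sym2.congr_right.mp (h1.trans h2.symm)
  · exact Option.some.inj h

theorem adj_subdivideNbr (u v : V) {c a : V} (h : G.Adj c a) :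
    (G.subdivide u v).Adj (some c) (subdivideNbr u v c a) := by
  unfold subdivideNbr
  split_ifs with h1
  · rcases Sym2.eq_iff.mp h1 with h2 | h2
    · exact Or.inl h2.1
    · exact Or.inr h2.1
  · exact ⟨h, h1⟩

theorem exists_subdivideNbr_eq {u v : V} (huv : G.Adj u v) {c : V} {b : Option V}
    (h : (G.subdivide u v).Adj (some c) b) : ∃ a, G.Adj c a ∧ subdivideNbr u v c a = b := by
  cases b with
  | none =>
    rcases (h : c = u ∨ c = v) with rfl | rfl
    · exact ⟨v, huv, if_pos rfl⟩
    · exact ⟨u, huv.symm, if_pos Sym2.eq_swap⟩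
  | some b => exact ⟨b, h.1, if_neg h.2⟩

/-- The dart of the subdivided graph in which the dart `d` of `G` starts. -/
noncomputable def Dart.subdivideStart (u v : V) (d : G.Dart) : (G.subdivide u v).Dart :=
  ⟨(some d.fst, subdivideNbr u v d.fst d.snd), adj_subdivideNbr u v d.adj⟩

/-- The dart of the subdivided graph in which the dart `d` of `G` ends. -/
noncomputable def Dart.subdivideEnd (u v : V) (d : G.Dart) : (G.subdivide u v).Dart :=
  (d.symm.subdivideStart u v).symm

theorem Dart.subdivideEnd_injective (u v : V) :
    Function.Injective (Dart.subdivideEnd u v : G.Dart → _) := by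
  intro d e h
  have h1 : some d.snd = some e.snd := congrArg (fun d => d.snd) h
  have h2 : subdivideNbr u v d.snd d.fst = subdivideNbr u v e.snd e.fst :=
    congrArg (fun d => d.fst) h
  have h3 : d.snd = e.snd := Option.some.inj h1
  rw [← h3] at h2
  exact Dart.ext _ _ (Prod.ext (subdivideNbr_injective _ _ _ h2) h3)

theorem Dart.exists_subdivideStart_eq {u v : V} (huv : G.Adj u v) (d : (G.subdivide u v).Dart)
    {c : V} (hc : d.fst = some c) : ∃ e : G.Dart, e.subdivideStart u v = d := by
  obtain ⟨a, ha, hd⟩ := exists_subdivideNbr_eq (b := d.snd) huv (hc ▸ d.adj)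
  exact ⟨⟨(c, a), ha⟩, Dart.ext _ _ (Prod.ext hc.symm hd)⟩

theorem Dart.exists_subdivideEnd_eq {u v : V} (huv : G.Adj u v) (d : (G.subdivide u v).Dart)
    {c : V} (hc : d.snd = some c) : ∃ e : G.Dart, e.subdivideEnd u v = d := by
  obtain ⟨e, he⟩ := Dart.exists_subdivideStart_eq huv d.symm hc
  exact ⟨e.symm, by rw [Dart.subdivideEnd, Dart.symm_symm, he, Dart.symm_symm]⟩

theorem Dart.subdivideEnd_follows_iff {u v : V} {j i : G.Dart} :
    (j.subdivideEnd u v).Follows (i.subdivideStart u v) ↔ j.Follows i := by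
  change some j.snd = some i.fst ∧
    subdivideNbr u v j.snd j.fst ≠ subdivideNbr u v i.fst i.snd ↔ j.snd = i.fst ∧ j.fst ≠ i.snd
  rw [Option.some_inj]
  refine and_congr_right fun h => ?_
  rw [h, (subdivideNbr_injective u v i.fst).ne_iff]

theorem Dart.subdivideEnd_eq_subdivideStart {u v : V} {d : G.Dart} (h : d.edge ≠ s(u, v)) :
    d.subdivideEnd u v = d.subdivideStart u v := by
  have h1 : s(d.fst, d.snd) ≠ s(u, v) := h
  have h2 : s(d.snd, d.fst) ≠ s(u, v) := fun e => h1 (Sym2.eq_swap.trans e)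
  refine Dart.ext _ _ (Prod.ext ?_ ?_)
  · exact if_neg h2
  · exact (if_neg h1).symm

/-- The only dart that continues into the second half of the subdivided edge is its first half. -/
theorem Dart.follows_subdivideEnd_iff {u v : V} {d : G.Dart} (h : d.edge = s(u, v))
    {e : (G.subdivide u v).Dart} :
    e.Follows (d.subdivideEnd u v) ↔ e = d.subdivideStart u v := by
  have h1 : s(d.fst, d.snd) = s(u, v) := h
  have h2 : s(d.snd, d.fst) = s(u, v) := Sym2.eq_swap.trans h1
  have hs : subdivideNbr u v d.fst d.snd = none := if_pos h1
  have he : subdivideNbr u v d.snd d.fst = none := if_pos h2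
  constructor
  · rintro ⟨e1, e2⟩
    have e1 : e.snd = none := e1.trans he
    have e2 : e.fst ≠ some d.snd := e2
    refine Dart.ext _ _ (Prod.ext ?_ (e1.trans hs.symm))
    change e.fst = some d.fst
    have hadj := e.adj
    rw [e1] at hadj
    match hf : e.fst with
    | none => rw [hf] at hadj; exact hadj.elim
    | some c =>
      rw [hf] at hadj e2
      have hadj : c = u ∨ c = v := hadj
      have hc : c ∈ s(d.fst, d.snd) := by
        rw [h1, Sym2.mem_iff]
        exact hadj
      rcases Sym2.mem_iff.mp hc with hc | hc
      · rw [hc]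
      · exact absurd (congrArg some hc) e2
  · rintro rfl
    exact ⟨hs.trans he.symm, fun e => d.fst_ne_snd (Option.some.inj e)⟩

open Classical in
theorem sysMatrix_subdivide_mulVec_start [Fintype G.Dart] {u v : V}
    [Fintype (G.subdivide u v).Dart] (huv : G.Adj u v) (y : (G.subdivide u v).Dart → ℝ)
    (i : G.Dart) : ((G.subdivide u v).sysMatrix.mulVec y) (i.subdivideStart u v) =
      ∑ j : G.Dart with j.Follows i, y (j.subdivideEnd u v) := by
  rw [sysMatrix_mulVec]
  symm
  refine Finset.sum_bij (fun j _ => j.subdivideEnd u v) ?_ ?_ ?_ fun _ _ => rfl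
  · intro j hj
    rw [Finset.mem_filter] at hj ⊢
    exact ⟨Finset.mem_univ _, Dart.subdivideEnd_follows_iff.mpr hj.2⟩
  · intro j _ k _ h
    exact Dart.subdivideEnd_injective u v h
  · intro d hd
    obtain ⟨j, rfl⟩ := Dart.exists_subdivideEnd_eq huv d (Finset.mem_filter.mp hd).2.1
    refine ⟨j, ?_, rfl⟩
    rw [Finset.mem_filter] at hd ⊢
    exact ⟨Finset.mem_univ _, Dart.subdivideEnd_follows_iff.mp hd.2⟩

theorem sysMatrix_subdivide_mulVec_end {u v : V} [Fintype (G.subdivide u v).Dart]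
    (y : (G.subdivide u v).Dart → ℝ) {d : G.Dart} (h : d.edge = s(u, v)) :
    ((G.subdivide u v).sysMatrix.mulVec y) (d.subdivideEnd u v) = y (d.subdivideStart u v) := by
  classical
  rw [sysMatrix_mulVec]
  have : (Finset.univ.filter fun e => Dart.Follows e (d.subdivideEnd u v)) =
      {d.subdivideStart u v} := by
    ext e
    rw [Finset.mem_filter, Finset.mem_singleton, Dart.follows_subdivideEnd_iff h]
    exact and_iff_right (Finset.mem_univ e)
  rw [this, Finset.sum_singleton]

/-- Subdividing an edge strictly decreases the spectral radius. With `μ = ρ(G_{uv})`, a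
subinvariant vector `y` of the subdivided graph is pulled back to `x d = y (first half of d)`.
For `1 < μ` the entry of `y` drops along the subdivided edge, so `x` is subinvariant for `μ` in
`G`; it is no eigenvector, since that would make its entry at the edge `uv` vanish. -/
theorem rhoSys_subdivide_lt [Fintype V] [DecidableRel G.Adj] (hconn : G.Connected)
    (hdeg : ∀ v, 2 ≤ G.degree v) (hthree : ∃ v, 3 ≤ G.degree v) {u v : V} (huv : G.Adj u v) :
    (G.subdivide u v).rhoSys < G.rhoSys := by
  classical
  have : Nonempty (G.subdivide u v).Dart := ⟨Dart.subdivideStart u v ⟨(u, v), huv⟩⟩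
  obtain ⟨μ, y, hρ, hμ0, hy, hy0, hsub⟩ :=
    Matrix.exists_rho_eq_ofReal (sysMatrix_nonneg (G := G.subdivide u v))
  rw [rhoSys_eq, hρ]
  rcases le_or_gt μ 1 with hμ | hμ
  · calc ENNReal.ofReal μ ≤ 1 := by simpa using hμ
      _ < _ := one_lt_rhoSys hconn hdeg hthree
  rw [rhoSys_eq]
  have hedge : ∀ d : G.Dart, d.edge = s(u, v) →
      μ * y (d.subdivideEnd u v) ≤ y (d.subdivideStart u v) := fun d hd => by
    rw [← sysMatrix_subdivide_mulVec_end y hd]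
    exact hsub _
  have hdrop : ∀ d : G.Dart, y (d.subdivideEnd u v) ≤ y (d.subdivideStart u v) := fun d => by
    by_cases hd : d.edge = s(u, v)
    · exact (le_mul_of_one_le_left (hy _) hμ.le).trans (hedge d hd)
    · rw [Dart.subdivideEnd_eq_subdivideStart hd]
  let x : G.Dart → ℝ := fun d => y (d.subdivideStart u v)
  have hx : 0 ≤ x := fun d => hy _
  have hx0 : x ≠ 0 := fun h0 => hy0 (by
    funext d
    match hf : d.fst, hs : d.snd with
    | some c, _ =>
      obtain ⟨e, rfl⟩ := Dart.exists_subdivideStart_eq huv d hf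
      exact congrFun h0 e
    | none, some c =>
      obtain ⟨e, rfl⟩ := Dart.exists_subdivideEnd_eq huv d hs
      exact le_antisymm ((hdrop e).trans (congrFun h0 e).le) (hy _)
    | none, none =>
      have := d.adj
      rw [hf, hs] at this
      exact this.elim)
  have hirr := reflTransGen_sysMatrix_pos hconn hdeg hthree
  refine Matrix.ofReal_lt_rho sysMatrix_nonneg hirr hμ0 hx (fun i => ?_) fun heq => ?_
  · calc μ * x i ≤ _ := hsub _
      _ = _ := sysMatrix_subdivide_mulVec_start huv y i
      _ ≤ _ := Finset.sum_le_sum fun j _ => hdrop j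
      _ = _ := (sysMatrix_mulVec x i).symm
  · let d : G.Dart := ⟨(u, v), huv⟩
    obtain ⟨z, hz, hzu⟩ := exists_adj_ne hdeg v u
    let i : G.Dart := ⟨(v, z), hz⟩
    have hdi : d.Follows i := ⟨rfl, hzu.symm⟩
    have hsum : ∑ j with j.Follows i, x j ≤ ∑ j : G.Dart with j.Follows i, y (j.subdivideEnd u v) := by
      rw [← sysMatrix_mulVec, heq, ← sysMatrix_subdivide_mulVec_start huv]
      exact hsub _
    have hle : x d ≤ y (d.subdivideEnd u v) := by
      by_contra! hlt
      exact absurd hsum (not_le.mpr (Finset.sum_lt_sum (fun j _ => hdrop j)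
        ⟨d, Finset.mem_filter.mpr ⟨Finset.mem_univ _, hdi⟩, hlt⟩))
    have hpos : 0 < x d := Matrix.pos_of_mulVec_eq sysMatrix_nonneg hirr hμ0 hx hx0 heq d
    have h1 : μ * y (d.subdivideEnd u v) ≤ x d := hedge d rfl
    nlinarith

end SimpleGraph

/-! ### Paths with two chords -/

/-- The path `0, 1, …, N - 1` together with the chords `{0, b}` and `{c, N - 1}`. It is a theta
graph for `c < b` and a dumbbell graph for `b ≤ c`. -/
def chordedPath (N b c : ℕ) : SimpleGraph (Fin N) :=
  SimpleGraph.fromRel fun i j =>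
    (j : ℕ) = i + 1 ∨ ((i : ℕ) = 0 ∧ (j : ℕ) = b) ∨ ((i : ℕ) = c ∧ (j : ℕ) + 1 = N)

theorem chordedPath_adj_iff {N b c : ℕ} {i j : Fin N} : (chordedPath N b c).Adj i j ↔
    (i : ℕ) ≠ j ∧ (((j : ℕ) = i + 1 ∨ ((i : ℕ) = 0 ∧ (j : ℕ) = b) ∨
      ((i : ℕ) = c ∧ (j : ℕ) + 1 = N)) ∨ ((i : ℕ) = j + 1 ∨ ((j : ℕ) = 0 ∧ (i : ℕ) = b) ∨
      ((j : ℕ) = c ∧ (i : ℕ) + 1 = N))) := by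
  rw [chordedPath, SimpleGraph.fromRel_adj, Ne, Fin.ext_iff]

theorem chordedPath_connected {N b c : ℕ} (hN : 0 < N) : (chordedPath N b c).Connected := by
  have h : ∀ (k : ℕ) (hk : k < N), (chordedPath N b c).Reachable ⟨0, hN⟩ ⟨k, hk⟩ := by
    intro k
    induction k with
    | zero => exact fun _ => SimpleGraph.Reachable.refl _
    | succ k ih =>
      intro hk
      refine (ih (by omega)).trans (SimpleGraph.Adj.reachable ?_)
      rw [chordedPath_adj_iff]
      exact ⟨by simp, Or.inl (Or.inl rfl)⟩
  have : Nonempty (Fin N) := ⟨⟨0, hN⟩⟩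
  exact ⟨fun i j => (h i i.2).symm.trans (h j j.2)⟩

theorem two_le_degree_chordedPath {N b c : ℕ} [DecidableRel (chordedPath N b c).Adj]
    (hb : 2 ≤ b) (hbN : b + 2 ≤ N) (hcN : c + 3 ≤ N) (i : Fin N) :
    2 ≤ (chordedPath N b c).degree i := by
  have key : ∃ (j k : Fin N), (chordedPath N b c).Adj i j ∧ (chordedPath N b c).Adj i k ∧
      j ≠ k := by
    simp only [chordedPath_adj_iff, ne_eq, Fin.ext_iff]
    have hi := i.2
    by_cases h0 : (i : ℕ) = 0
    · refine ⟨⟨1, by omega⟩, ⟨b, by omega⟩, ?_⟩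
      dsimp only; omega
    · by_cases h1 : (i : ℕ) + 1 = N
      · refine ⟨⟨i - 1, by omega⟩, ⟨c, by omega⟩, ?_⟩
        dsimp only; omega
      · refine ⟨⟨i - 1, by omega⟩, ⟨i + 1, by omega⟩, ?_⟩
        dsimp only; omega
  obtain ⟨j, k, hj, hk, hjk⟩ := key
  rw [← SimpleGraph.card_neighborFinset_eq_degree]
  exact Finset.one_lt_card.mpr ⟨j, by simpa using hj, k, by simpa using hk, hjk⟩

theorem three_le_degree_chordedPath {N b c : ℕ} [DecidableRel (chordedPath N b c).Adj]
    (hb : 2 ≤ b) (hbN : b + 2 ≤ N) :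
    3 ≤ (chordedPath N b c).degree ⟨b, by omega⟩ := by
  rw [← SimpleGraph.card_neighborFinset_eq_degree]
  refine Finset.two_lt_card.mpr ⟨⟨0, by omega⟩, ?_, ⟨b - 1, by omega⟩, ?_,
    ⟨b + 1, by omega⟩, ?_, ?_⟩
  all_goals
    simp only [SimpleGraph.mem_neighborFinset, chordedPath_adj_iff, ne_eq, Fin.ext_iff, true_or,
      or_true, and_true]
    omega

/-- The bijection that inserts the new vertex `none` right after the vertex `k`. -/
def insertAfterEquiv (N k : ℕ) (hk : k + 1 < N) : Option (Fin N) ≃ Fin (N + 1) :=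
  (finSuccEquiv' (⟨k + 1, by omega⟩ : Fin (N + 1))).symm

theorem insertAfterEquiv_none (N k : ℕ) (hk : k + 1 < N) :
    (insertAfterEquiv N k hk none : ℕ) = k + 1 := by
  simp [insertAfterEquiv]

theorem insertAfterEquiv_some (N k : ℕ) (hk : k + 1 < N) (i : Fin N) :
    (insertAfterEquiv N k hk (some i) : ℕ) = if (i : ℕ) ≤ k then (i : ℕ) else i + 1 := by
  simp only [insertAfterEquiv, finSuccEquiv'_symm_some, Fin.succAbove, Fin.lt_def,
    Fin.val_castSucc, Nat.lt_succ_iff]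
  split_ifs <;> rfl

/-- Subdividing the path edge `{k, k + 1}` shifts the chord ends beyond it by one. -/
def subdivideChordedPathIso (N k b c b' c' : ℕ) (hk : k + 1 < N) (hb : 2 ≤ b) (hbN : b + 2 ≤ N)
    (hcN : c + 3 ≤ N) (hb' : b' = if b ≤ k then b else b + 1)
    (hc' : c' = if c ≤ k then c else c + 1) :
    (chordedPath N b c).subdivide ⟨k, by omega⟩ ⟨k + 1, hk⟩ ≃g chordedPath (N + 1) b' c' where
  toEquiv := insertAfterEquiv N k hk
  map_rel_iff' := by
    -- the shift is injective, misses `k + 1`, and turns every adjacency condition but that of the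
    -- edge `{k, k + 1}` into the same condition before the shift
    have hinj (m l : ℕ) : ((if m ≤ k then m else m + 1) = if l ≤ k then l else l + 1) ↔
        m = l := by grind
    have hsucc (m l : ℕ) : ((if m ≤ k then m else m + 1) = (if l ≤ k then l else l + 1) + 1) ↔
        m = l + 1 ∧ l ≠ k := by grind
    have hzero (m : ℕ) : (if m ≤ k then m else m + 1) = 0 ↔ m = 0 := by grind
    have hlast (m : ℕ) : (if m ≤ k then m else m + 1) + 1 = N + 1 ↔ m + 1 = N := by grind
    have hmiss (m : ℕ) : ¬ (k + 1 = if m ≤ k then m else m + 1) := by grind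
    have hleft (m : ℕ) : (k + 1 = (if m ≤ k then m else m + 1) + 1) ↔ m = k := by grind
    have hright (m : ℕ) : ((if m ≤ k then m else m + 1) = k + 1 + 1) ↔ m = k + 1 := by grind
    have hend : k + 1 + 1 ≠ N + 1 := by omega
    subst hb' hc'
    rintro (_ | i) (_ | j)
    · simp [SimpleGraph.subdivide]
    · change _ ↔ (j = _ ∨ j = _)
      rw [chordedPath_adj_iff, insertAfterEquiv_none, insertAfterEquiv_some, Fin.ext_iff,
        Fin.ext_iff]
      simp only [ne_eq, hmiss, hleft, hright, hend, Nat.add_one_ne_zero, false_and, and_false,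
        or_false, not_false_eq_true, true_and]
      omega
    · change _ ↔ (i = _ ∨ i = _)
      rw [chordedPath_adj_iff, insertAfterEquiv_none, insertAfterEquiv_some, Fin.ext_iff,
        Fin.ext_iff, ne_comm]
      simp only [ne_eq, hmiss, hleft, hright, hend, Nat.add_one_ne_zero, false_and, and_false,
        or_false, not_false_eq_true, true_and]
    · change _ ↔ ((chordedPath N b c).Adj i j ∧ s(i, j) ≠ _)
      rw [chordedPath_adj_iff, chordedPath_adj_iff, insertAfterEquiv_some, insertAfterEquiv_some]
      simp only [ne_eq, Sym2.eq_iff, Fin.ext_iff, hinj, hsucc, hzero, hlast]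
      omega

theorem rhoSys_chordedPath_lt (N k b c b' c' : ℕ) (hk : k + 1 < N) (hb : 2 ≤ b)
    (hbN : b + 2 ≤ N) (hcN : c + 3 ≤ N) (hb' : b' = if b ≤ k then b else b + 1)
    (hc' : c' = if c ≤ k then c else c + 1) :
    (chordedPath (N + 1) b' c').rhoSys < (chordedPath N b c).rhoSys := by
  classical
  rw [← SimpleGraph.rhoSys_congr (subdivideChordedPathIso N k b c b' c' hk hb hbN hcN hb' hc')]
  refine SimpleGraph.rhoSys_subdivide_lt (chordedPath_connected (by omega))
    (two_le_degree_chordedPath hb hbN hcN) ⟨_, three_le_degree_chordedPath hb hbN⟩ ?_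
  rw [chordedPath_adj_iff]
  exact ⟨by simp, Or.inl (Or.inl rfl)⟩

/-! ### Theta graphs, dumbbell graphs and the general case -/

/-- With `N = l₁ + l₂ + l₃ - 1` as a variable, so that the vertex types of a theta graph and of its
subdivision can be matched. -/
theorem rhoSys_thetaGraph (l₁ l₂ l₃ N : ℕ) (h₁ : 1 ≤ l₁) (h₂ : 2 ≤ l₂)
    (hN : N = l₁ + l₂ + l₃ - 1) :
    (thetaGraph l₁ l₂ l₃).rhoSys = (chordedPath N (l₁ + l₂ - 1) (l₂ - 1)).rhoSys := by
  subst hN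
  congr 1
  ext i j
  rw [chordedPath_adj_iff, thetaGraph, SimpleGraph.fromRel_adj, Ne, Fin.ext_iff]
  have := i.2
  have := j.2
  omega

/-- As for `rhoSys_thetaGraph`, the number of vertices is a variable. -/
theorem rhoSys_dumbbellGraph (r₁ r₂ q N : ℕ) (h₁ : 3 ≤ r₁) (h₂ : 3 ≤ r₂)
    (hN : N = r₁ + q + r₂ - 1) :
    (dumbbellGraph r₁ r₂ q).rhoSys = (chordedPath N (r₁ - 1) (r₁ + q - 1)).rhoSys := by
  subst hN
  congr 1
  ext i j
  rw [chordedPath_adj_iff, dumbbellGraph, SimpleGraph.fromRel_adj, Ne, Fin.ext_iff]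
  have := i.2
  have := j.2
  omega

theorem corollary3 :
    (∀ {V : Type*} [Fintype V] (G : SimpleGraph V) [DecidableRel G.Adj],
      G.Connected → (∀ v, G.degree v ≠ 1) → ¬ G.IsCycleGraph →
      (¬ ∃ d, G.IsRegularOfDegree d) →
      ∀ u v, G.Adj u v → (G.subdivide u v).rhoSys < G.rhoSys) ∧
    (∀ l₁ l₂ l₃ : ℕ, 1 ≤ l₁ → 2 ≤ l₂ → 2 ≤ l₃ →
      (thetaGraph (l₁ + 1) l₂ l₃).rhoSys < (thetaGraph l₁ l₂ l₃).rhoSys ∧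
      (thetaGraph l₁ (l₂ + 1) l₃).rhoSys < (thetaGraph l₁ l₂ l₃).rhoSys ∧
      (thetaGraph l₁ l₂ (l₃ + 1)).rhoSys < (thetaGraph l₁ l₂ l₃).rhoSys) ∧
    (∀ r₁ r₂ q : ℕ, 3 ≤ r₁ → 3 ≤ r₂ →
      (dumbbellGraph (r₁ + 1) r₂ q).rhoSys < (dumbbellGraph r₁ r₂ q).rhoSys ∧
      (dumbbellGraph r₁ (r₂ + 1) q).rhoSys < (dumbbellGraph r₁ r₂ q).rhoSys ∧
      (1 ≤ q → (dumbbellGraph r₁ r₂ (q + 1)).rhoSys < (dumbbellGraph r₁ r₂ q).rhoSys)) := by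
  refine ⟨?_, ?_, ?_⟩
  · intro V _ G _ hconn hne1 _ hreg u v huv
    have : Nontrivial V := ⟨u, v, huv.ne⟩
    have hdeg : ∀ v, 2 ≤ G.degree v := fun v => by
      have h0 := hconn.preconnected.degree_pos_of_nontrivial v
      have h1 := hne1 v
      omega
    refine SimpleGraph.rhoSys_subdivide_lt hconn hdeg ?_ huv
    by_contra! hcon
    exact hreg ⟨2, fun w => le_antisymm (Nat.le_of_lt_succ (hcon w)) (hdeg w)⟩
  · intro l₁ l₂ l₃ h₁ h₂ h₃
    rw [rhoSys_thetaGraph l₁ l₂ l₃ _ h₁ h₂ rfl]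
    refine ⟨?_, ?_, ?_⟩
    · rw [rhoSys_thetaGraph (l₁ + 1) l₂ l₃ (l₁ + l₂ + l₃ - 1 + 1) (by omega) h₂ (by omega)]
      apply rhoSys_chordedPath_lt _ (l₂ - 1)
      all_goals first | omega | split_ifs <;> omega
    · rw [rhoSys_thetaGraph l₁ (l₂ + 1) l₃ (l₁ + l₂ + l₃ - 1 + 1) h₁ (by omega) (by omega)]
      apply rhoSys_chordedPath_lt _ 0
      all_goals first | omega | split_ifs <;> omega
    · rw [rhoSys_thetaGraph l₁ l₂ (l₃ + 1) (l₁ + l₂ + l₃ - 1 + 1) h₁ h₂ (by omega)]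
      apply rhoSys_chordedPath_lt _ (l₁ + l₂ - 1)
      all_goals first | omega | split_ifs <;> omega
  · intro r₁ r₂ q h₁ h₂
    rw [rhoSys_dumbbellGraph r₁ r₂ q _ h₁ h₂ rfl]
    refine ⟨?_, ?_, fun hq => ?_⟩
    · rw [rhoSys_dumbbellGraph (r₁ + 1) r₂ q (r₁ + q + r₂ - 1 + 1) (by omega) h₂ (by omega)]
      apply rhoSys_chordedPath_lt _ 0
      all_goals first | omega | split_ifs <;> omega
    · rw [rhoSys_dumbbellGraph r₁ (r₂ + 1) q (r₁ + q + r₂ - 1 + 1) h₁ (by omega) (by omega)]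
      apply rhoSys_chordedPath_lt _ (r₁ + q - 1)
      all_goals first | omega | split_ifs <;> omega
    · rw [rhoSys_dumbbellGraph r₁ r₂ (q + 1) (r₁ + q + r₂ - 1 + 1) h₁ h₂ (by omega)]
      apply rhoSys_chordedPath_lt _ (r₁ - 1)
      all_goals first | omega | split_ifs <;> omega
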